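/- Let $p,q\ge 0$ with $p+q=2$, let $(e_1,e_2)$ be the diagonal of $\mathrm{diag}(+_p,-_q)$, and let $V\neq 0$ be a finite-dimensional complex inner product space with linear operators $\gamma^1,\gamma^2$ such that $(\gamma^\mu)^2=e_\mu$, $(\gamma^\mu)^*=e_\mu\gamma^\mu$ and $\gamma^1\gamma^2=-\gamma^2\gamma^1$. For $N\ge 1$ let $\mathcal M_N$ be the set of pairs $X=(X_1,X_2)=(A,B)$ of complex $N\times N$ matrices such that $X_\mu$ is Hermitian if $e_\mu=+1$ and traceless anti-Hermitian if $e_\mu=-1$. The Dirac operator of the $2$-dimensional fuzzy geometry with parameters $(A,B)\in\mathcal M_N$ is $$D=\gamma^1\otimes k_1+\gamma^2\otimes k_2\quad\text{on } V\otimes M_N(\mathbb C),\qquad k_\mu(Y)=X_\mu Y+e_\mu YX_\mu .$$ A trace polynomial is a complex polynomial in formal commuting symbols $\operatorname{Tr}(c)$, one for each cyclic word $c$ in the letters $A,B$, including the empty word $1$. It is evaluated at $(A,B)\in\mathcal M_N$ by replacing every $\operatorname{Tr}(c)$ by the trace $\operatorname{Tr}_N$ of the corresponding product of matrices; in particular $\operatorname{Tr}(1)$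 becomes $N$. A trace polynomial $P$ is called an expansion of $\operatorname{Tr}D^m$ if $\operatorname{Tr}D^m=P(A,B)$ for all $N\ge1$ and all $(A,B)\in\mathcal M_N$ (with $P$ not depending on $N$). **Lemma.** Let $w$ be a (possibly empty) word in the letters $A,B$ with $\deg_A(w)$ and $\deg_B(w)$ even, and let $m=\deg_A(w)+\deg_B(w)$. Then $\operatorname{Tr}D^m$ has an expansion, and $\operatorname{Tr}_N w$ has a well-defined non-zero coefficient in it: there is a complex number $c\neq0$ such that in every expansion $P$ of $\operatorname{Tr}D^m$ the coefficient of the monomial $\operatorname{Tr}(1)\cdot\operatorname{Tr}(w)$, whose value at $(A,B)\in\mathcal M_N$ is $N\cdot\operatorname{Tr}_N w$, equals $c$. -/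

import Mathlib

open scoped TensorProduct

namespace FuzzyGeometry

/-- The diagonal entries `e₁, e₂` of `diag(+_p, -_q)`, `p + q = 2`: the sign is `+1` for the first `p`
indices and `-1` for the remaining ones. The index set `{1, 2}` is `Fin 2`. -/
def metricSign (p : ℕ) (μ : Fin 2) : ℂ := if (μ : ℕ) < p then 1 else -1

/-- Gamma matrices of signature `(p, 2 - p)` on an inner product space `V`: the action on `V` of the
orthonormal basis of `ℝ^{p,q}` in a Clifford module, the time-like ones being Hermitian
with square `+1` and the spatial ones anti-Hermitian with square `-1`. -/
structure GammaMatrices (p : ℕ) (V : Type*) [NormedAddCommGroup V] [InnerProductSpace ℂ V]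
    [FiniteDimensional ℂ V] where
  /-- the matrices `γ¹, γ²` -/
  γ : Fin 2 → Module.End ℂ V
  sq_eq : ∀ μ, γ μ * γ μ = metricSign p μ • (1 : Module.End ℂ V)
  anticomm : ∀ μ ν, μ ≠ ν → γ μ * γ ν + γ ν * γ μ = 0
  adjoint_eq : ∀ μ, LinearMap.adjoint (γ μ) = metricSign p μ • γ μ

/-- The parameter space of the Dirac operators of the 2-dimensional fuzzy geometries
of signature `(p, 2 - p)`: pairs `X = (A, B)` of `N × N` matrices, `X μ` being
Hermitian if `e_μ = +1` and traceless anti-Hermitian if `e_μ = -1`. -/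
def diracParameters (p N : ℕ) : Set (Fin 2 → Matrix (Fin N) (Fin N) ℂ) :=
  {X | ∀ μ, (X μ).conjTranspose = metricSign p μ • X μ ∧
    (metricSign p μ = -1 → (X μ).trace = 0)}

/-- The operator `k_μ(Y) = X_μ Y + e_μ Y X_μ` on `M_N(ℂ)`. -/
def kOp {N : ℕ} (p : ℕ) (X : Fin 2 → Matrix (Fin N) (Fin N) ℂ) (μ : Fin 2) :
    Module.End ℂ (Matrix (Fin N) (Fin N) ℂ) :=
  LinearMap.mulLeft ℂ (X μ) + metricSign p μ • LinearMap.mulRight ℂ (X μ)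

/-- The Dirac operator `D = γ¹ ⊗ k₁ + γ² ⊗ k₂` on `V ⊗ M_N(ℂ)`. -/
noncomputable def dirac {p : ℕ} {V : Type*} [NormedAddCommGroup V] [InnerProductSpace ℂ V]
    [FiniteDimensional ℂ V] (G : GammaMatrices p V) {N : ℕ}
    (X : Fin 2 → Matrix (Fin N) (Fin N) ℂ) :
    Module.End ℂ (V ⊗[ℂ] Matrix (Fin N) (Fin N) ℂ) :=
  ∑ μ, TensorProduct.map (G.γ μ) (kOp p X μ)

theorem trace_prod_eq_of_isRotated {N : ℕ} (X : Fin 2 → Matrix (Fin N) (Fin N) ℂ)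
    {l l' : List (Fin 2)} (h : l ~r l') :
    ((l.map X).prod).trace = ((l'.map X).prod).trace := by
  obtain ⟨n, rfl⟩ := h
  induction n with
  | zero => simp
  | succ n ih =>
    rw [ih, ← List.rotate_rotate]
    cases l.rotate n with
    | nil => simp
    | cons a t => simp [List.rotate_cons_succ, Matrix.trace_mul_comm (X a)]

/-- `Tr_N` of a cyclic word in the letters `A = X 0`, `B = X 1`; the empty word has trace `N`. -/
def traceWord {N : ℕ} (X : Fin 2 → Matrix (Fin N) (Fin N) ℂ) (c : Cycle (Fin 2)) : ℂ :=
  Quotient.liftOn c (fun l : List (Fin 2) => ((l.map X).prod).trace)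
    fun _ _ h => trace_prod_eq_of_isRotated X h

/-- Trace polynomials: complex polynomials in the formal symbols `Tr c`, with `c` a cyclic word in
two letters. The empty word is included: its symbol `Tr 1` takes the value `N` on
`N × N` matrices. -/
abbrev TracePolynomial : Type := MvPolynomial (Cycle (Fin 2)) ℂ

/-- The trace polynomial `P`, the same for all matrix sizes `N ≥ 1`, is the expansion of `Tr D^m`
in traces of words in the two matrices parametrizing the Dirac operator `D`. -/
def IsSpectralActionExpansion {p : ℕ} {V : Type*} [NormedAddCommGroup V]
    [InnerProductSpace ℂ V] [FiniteDimensional ℂ V] (G : GammaMatrices p V) (m : ℕ)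
    (P : TracePolynomial) : Prop :=
  ∀ N : ℕ, 1 ≤ N → ∀ X ∈ diracParameters p N,
    LinearMap.trace ℂ (V ⊗[ℂ] Matrix (Fin N) (Fin N) ℂ) (dirac G X ^ m) =
      MvPolynomial.eval (traceWord X) P

/-- The monomial `Tr 1 · Tr w` (it is `(Tr 1)²` if `w` is empty), which on `N × N` matrices
takes the value `N · Tr_N w`. -/
noncomputable def singleTraceMonomial (w : List (Fin 2)) : Cycle (Fin 2) →₀ ℕ :=
  Finsupp.single (([] : List (Fin 2)) : Cycle (Fin 2)) 1 + Finsupp.single (w : Cycle (Fin 2)) 1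

end FuzzyGeometry

namespace FuzzyGeometry

/-! Existence: `D` is a sum of four terms, each a gamma matrix tensored with a left or a right
multiplication. Multiplying out `D^m` and using Tr(Y ↦ aYb) = Tr a · Tr b gives `diracExpansion`.
The monomial Tr 1 · Tr w arises only when all letters act from one side and spell `w` up to rotation
(reversed, for the right side). As both letters occur an even number of times, each such term
contributes the same trace of a gamma word equal to ±1, so nothing cancels
(`coeff_diracExpansion_ne_zero`).

Uniqueness: the difference of two expansions vanishes at every vector of traces. Block sums make
these vectors additively closed, so it vanishes on their complex span (`eval_eq_zero_of_mem_span`).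
Apart from one-letter words forced to be traceless, traces of cyclic words are linearly independent,
as cyclic shift matrices show (`eq_zero_of_sum_mul_traceWord_eq_zero`). Hence the span fills every
finite set of admissible coordinates, and the difference has no monomial in admissible words only;
Tr 1 · Tr w is such a monomial. -/

theorem sum_pow_eq_sum_prod_ofFn {R ι : Type*} [Semiring R] [Fintype ι] (a : ι → R) (m : ℕ) :
    (∑ i, a i) ^ m = ∑ u : Fin m → ι, ((List.ofFn u).map a).prod := by
  induction m with
  | zero => simp
  | succ m ih =>
    rw [pow_succ', ih, Finset.sum_mul_sum, ← Finset.sum_product', Finset.univ_product_univ]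
    exact Fintype.sum_equiv (Fin.consEquiv fun _ => ι) _ _ fun x => by
      simp [Fin.consEquiv, List.ofFn_succ]

/-- The coefficient of the matrix unit `E i j` in `a * E i j * b` is `a i i * b j j`. -/
theorem trace_mulLeft_comp_mulRight {n : Type*} [Fintype n] [DecidableEq n]
    (a b : Matrix n n ℂ) :
    LinearMap.trace ℂ (Matrix n n ℂ) (LinearMap.mulLeft ℂ a * LinearMap.mulRight ℂ b) =
      a.trace * b.trace := by
  rw [LinearMap.trace_eq_matrix_trace ℂ (Matrix.stdBasis ℂ n n), Matrix.trace,
    Fintype.sum_prod_type, Matrix.trace, Matrix.trace, Finset.sum_mul_sum]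
  refine Finset.sum_congr rfl fun i _ => Finset.sum_congr rfl fun j _ => ?_
  have h : ∀ M : Matrix n n ℂ, (Matrix.stdBasis ℂ n n).repr M (i, j) = M i j := fun M => by
    simp [Matrix.stdBasis]
  rw [Matrix.diag_apply, LinearMap.toMatrix_apply, h, Matrix.stdBasis_eq_single]
  simp [Matrix.mul_apply, Matrix.single_apply, ite_and]

/-- The letters that are multiplied from the left. -/
def leftWord (u : List (Fin 2 × Bool)) : List (Fin 2) := (u.filter (·.2)).map Prod.fst

/-- The letters that are multiplied from the right. -/
def rightWord (u : List (Fin 2 × Bool)) : List (Fin 2) := (u.filter (!·.2)).map Prod.fst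

/-- The product of the metric signs of the letters of a word. -/
def wordSign (p : ℕ) (v : List (Fin 2)) : ℂ := (v.map (metricSign p)).prod

/-! ### Multiplying out `Tr D^m` -/

section Expansion

variable {p : ℕ} {V : Type*} [NormedAddCommGroup V] [InnerProductSpace ℂ V]
  [FiniteDimensional ℂ V] (G : GammaMatrices p V)

/-- The product of gamma matrices along a word. -/
def GammaMatrices.word (v : List (Fin 2)) : Module.End ℂ V := (v.map G.γ).prod

/-- One of the four terms of the Dirac operator: a gamma matrix tensored with a multiplication from
the left or from the right. -/
noncomputable def diracTerm {N : ℕ} (X : Fin 2 → Matrix (Fin N) (Fin N) ℂ) (i : Fin 2 × Bool) :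
    Module.End ℂ (V ⊗[ℂ] Matrix (Fin N) (Fin N) ℂ) :=
  TensorProduct.map (G.γ i.1)
    (bif i.2 then LinearMap.mulLeft ℂ (X i.1)
      else metricSign p i.1 • LinearMap.mulRight ℂ (X i.1))

theorem dirac_eq_sum_diracTerm {N : ℕ} (X : Fin 2 → Matrix (Fin N) (Fin N) ℂ) :
    dirac G X = ∑ i, diracTerm G X i := by
  rw [Fintype.sum_prod_type]
  simp [dirac, diracTerm, kOp, TensorProduct.map_add_right]

/-- Left and right multiplications commute, and right multiplications compose in the opposite order;
hence the reversal. -/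
theorem prod_map_diracTerm {N : ℕ} (X : Fin 2 → Matrix (Fin N) (Fin N) ℂ)
    (u : List (Fin 2 × Bool)) :
    (u.map (diracTerm G X)).prod = wordSign p (rightWord u) •
      TensorProduct.map (G.word (u.map Prod.fst))
        (LinearMap.mulLeft ℂ ((leftWord u).map X).prod *
          LinearMap.mulRight ℂ ((rightWord u).reverse.map X).prod) := by
  induction u with
  | nil =>
    simp [wordSign, rightWord, leftWord, GammaMatrices.word, Module.End.one_eq_id,
      Module.End.mul_eq_comp]
  | cons i u ih =>
    obtain ⟨μ, _ | _⟩ := i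
    · rw [List.map_cons, List.prod_cons, ih]
      simp only [diracTerm, wordSign, rightWord, leftWord, GammaMatrices.word, cond_false,
        List.map_cons, List.prod_cons, Bool.not_false, List.filter_cons_of_pos, List.reverse_cons,
        List.map_append, List.prod_append, List.map_nil, List.prod_nil, mul_one,
        TensorProduct.map_smul_right, Bool.false_eq_true, not_false_eq_true,
        List.filter_cons_of_neg, smul_mul_assoc, mul_smul_comm, smul_smul]
      rw [mul_comm (metricSign p μ), ← TensorProduct.map_mul]
      congr 2
      ext1 Y
      simp [mul_assoc]
    · rw [List.map_cons, List.prod_cons, ih]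
      simp only [diracTerm, wordSign, rightWord, leftWord, GammaMatrices.word, cond_true,
        List.map_cons, List.prod_cons, Bool.not_true, List.filter_cons_of_pos,
        Bool.false_eq_true, not_false_eq_true,
        List.filter_cons_of_neg, mul_smul_comm]
      rw [← TensorProduct.map_mul]
      congr 2
      ext1 Y
      simp

@[simp]
theorem traceWord_coe {N : ℕ} (X : Fin 2 → Matrix (Fin N) (Fin N) ℂ) (l : List (Fin 2)) :
    traceWord X (l : Cycle (Fin 2)) = ((l.map X).prod).trace := rfl

/-- The expansion of `Tr D^m` obtained by multiplying out. -/
noncomputable def diracExpansion (m : ℕ) : TracePolynomial :=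
  ∑ u : Fin m → Fin 2 × Bool,
    MvPolynomial.monomial
      (Finsupp.single (leftWord (List.ofFn u) : Cycle (Fin 2)) 1 +
        Finsupp.single ((rightWord (List.ofFn u)).reverse : Cycle (Fin 2)) 1)
      (wordSign p (rightWord (List.ofFn u)) *
        LinearMap.trace ℂ V (G.word ((List.ofFn u).map Prod.fst)))

theorem isSpectralActionExpansion_diracExpansion (m : ℕ) :
    IsSpectralActionExpansion G m (diracExpansion G m) := by
  intro N _ X _
  rw [dirac_eq_sum_diracTerm, sum_pow_eq_sum_prod_ofFn, diracExpansion, map_sum, map_sum]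
  refine Finset.sum_congr rfl fun u _ => ?_
  rw [prod_map_diracTerm, map_smul, LinearMap.trace_tensorProduct', trace_mulLeft_comp_mulRight,
    MvPolynomial.eval_monomial, Finsupp.prod_add_index' (by simp) (fun _ _ _ => pow_add _ _ _)]
  simp [mul_assoc]

theorem metricSign_mul_self (μ : Fin 2) : metricSign p μ * metricSign p μ = 1 := by
  unfold metricSign; split_ifs <;> norm_num

theorem wordSign_eq_pow (v : List (Fin 2)) :
    wordSign p v = metricSign p 0 ^ v.count 0 * metricSign p 1 ^ v.count 1 := by
  induction v with
  | nil => simp [wordSign]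
  | cons μ v ih =>
    rw [wordSign, List.map_cons, List.prod_cons, ← wordSign, ih]
    fin_cases μ <;> simp [pow_succ] <;> ring

theorem wordSign_eq_one {v : List (Fin 2)} (h0 : Even (v.count 0)) (h1 : Even (v.count 1)) :
    wordSign p v = 1 := by
  obtain ⟨a, ha⟩ := h0
  obtain ⟨b, hb⟩ := h1
  rw [wordSign_eq_pow, ha, hb, pow_add, pow_add, ← mul_pow, ← mul_pow, metricSign_mul_self,
    metricSign_mul_self, one_pow, one_pow, one_mul]

/-! ### Products of gamma matrices -/

theorem GammaMatrices.γ_one_mul_γ_zero_pow (a : ℕ) :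
    G.γ 1 * G.γ 0 ^ a = (-1 : ℂ) ^ a • (G.γ 0 ^ a * G.γ 1) := by
  induction a with
  | zero => simp
  | succ a ih =>
    have h : G.γ 1 * G.γ 0 = -(G.γ 0 * G.γ 1) :=
      eq_neg_of_add_eq_zero_left (G.anticomm 1 0 (by decide))
    rw [pow_succ, ← mul_assoc, ih, smul_mul_assoc, mul_assoc, h, pow_succ, mul_smul]
    simp [mul_assoc]

/-- Sorting the letters by anticommutation costs only signs; `ε * ε = 1` keeps track of that. -/
theorem GammaMatrices.word_eq_smul (v : List (Fin 2)) :
    ∃ ε : ℂ, ε * ε = 1 ∧ G.word v = ε • (G.γ 0 ^ v.count 0 * G.γ 1 ^ v.count 1) := by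
  induction v with
  | nil => exact ⟨1, by simp, by simp [word]⟩
  | cons μ v ih =>
    obtain ⟨ε, hε, h⟩ := ih
    have hc : G.word (μ :: v) = G.γ μ * G.word v := by simp [word]
    fin_cases μ
    · refine ⟨ε, hε, ?_⟩
      rw [hc, h]
      simp [pow_succ', mul_assoc]
    · refine ⟨ε * (-1) ^ v.count 0, ?_, ?_⟩
      · rw [mul_mul_mul_comm, hε, ← mul_pow]; simp
      · rw [hc, h]
        simp only [Fin.mk_one, mul_smul_comm]
        rw [← mul_assoc, G.γ_one_mul_γ_zero_pow, smul_mul_assoc, smul_smul]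
        simp [pow_succ', mul_assoc]

theorem GammaMatrices.word_of_even {v : List (Fin 2)} (h0 : Even (v.count 0))
    (h1 : Even (v.count 1)) : ∃ ε : ℂ, ε * ε = 1 ∧ G.word v = ε • 1 := by
  obtain ⟨ε, hε, h⟩ := G.word_eq_smul v
  obtain ⟨a, ha⟩ := h0
  obtain ⟨b, hb⟩ := h1
  refine ⟨ε * (metricSign p 0 ^ a * metricSign p 1 ^ b), ?_, ?_⟩
  · rw [mul_mul_mul_comm, hε, mul_mul_mul_comm, ← mul_pow, ← mul_pow, metricSign_mul_self,
      metricSign_mul_self]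
    simp
  · rw [h, ha, hb, pow_add, pow_add, ← (Commute.refl _).mul_pow, ← (Commute.refl _).mul_pow,
      G.sq_eq, G.sq_eq, smul_pow, smul_pow]
    simp [smul_smul, mul_comm]

theorem GammaMatrices.word_reverse_mul_word (v : List (Fin 2)) :
    G.word v.reverse * G.word v = wordSign p v • (1 : Module.End ℂ V) := by
  induction v with
  | nil => simp [word, wordSign]
  | cons μ v ih =>
    have e : G.word (μ :: v).reverse * G.word (μ :: v) =
        G.word v.reverse * (G.γ μ * G.γ μ) * G.word v := by
      simp [word, mul_assoc]
    rw [e, G.sq_eq, mul_smul_comm, smul_mul_assoc, mul_one, ih, smul_smul]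
    simp [wordSign]

/-- The word is a scalar `ε` with `ε * ε = 1`, and its reversal is an inverse, hence also `ε`. -/
theorem GammaMatrices.word_reverse_of_even {v : List (Fin 2)} (h0 : Even (v.count 0))
    (h1 : Even (v.count 1)) : G.word v.reverse = G.word v := by
  obtain ⟨ε, hε, h⟩ := G.word_of_even h0 h1
  have e := G.word_reverse_mul_word v
  rw [wordSign_eq_one h0 h1, h, mul_smul_comm, mul_one] at e
  rw [h, ← one_smul ℂ (G.word v.reverse), ← hε, mul_smul, e, one_smul]

theorem GammaMatrices.trace_word_ne_zero [Nontrivial V] {v : List (Fin 2)}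
    (h0 : Even (v.count 0)) (h1 : Even (v.count 1)) : LinearMap.trace ℂ V (G.word v) ≠ 0 := by
  obtain ⟨ε, hε, h⟩ := G.word_of_even h0 h1
  rw [h, map_smul, LinearMap.trace_one, smul_eq_mul]
  exact mul_ne_zero (left_ne_zero_of_mul_eq_one hε)
    (Nat.cast_ne_zero.2 Module.finrank_pos.ne')

theorem GammaMatrices.trace_word_eq_of_isRotated {v v' : List (Fin 2)} (h : v ~r v') :
    LinearMap.trace ℂ V (G.word v) = LinearMap.trace ℂ V (G.word v') := by
  obtain ⟨n, rfl⟩ := h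
  rw [List.rotate_eq_drop_append_take_mod]
  conv_lhs => rw [← List.take_append_drop (n % v.length) v]
  simp only [word, List.map_append, List.prod_append]
  exact LinearMap.trace_mul_comm ℂ _ _

theorem leftWord_eq_nil {u : List (Fin 2 × Bool)} (h : leftWord u = []) :
    rightWord u = u.map Prod.fst := by
  simp only [leftWord, List.map_eq_nil_iff, List.filter_eq_nil_iff] at h
  rw [rightWord, List.filter_eq_self.2 fun a ha => by simpa using h a ha]

theorem rightWord_eq_nil {u : List (Fin 2 × Bool)} (h : rightWord u = []) :
    leftWord u = u.map Prod.fst := by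
  simp only [rightWord, List.map_eq_nil_iff, List.filter_eq_nil_iff] at h
  rw [leftWord, List.filter_eq_self.2 fun a ha => by simpa using h a ha]

theorem coeff_diracExpansion_ne_zero [Nontrivial V] (w : List (Fin 2))
    (h0 : Even (w.count 0)) (h1 : Even (w.count 1)) :
    MvPolynomial.coeff (singleTraceMonomial w)
      (diracExpansion G (w.count 0 + w.count 1)) ≠ 0 := by
  classical
  have hlen : w.count 0 + w.count 1 = w.length := by
    clear h0 h1
    induction w with
    | nil => simp
    | cons μ w ih => fin_cases μ <;> simp <;> omega
  rw [hlen, diracExpansion, MvPolynomial.coeff_sum]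
  simp only [MvPolynomial.coeff_monomial]
  rw [← Finset.sum_filter]
  -- Every contributing `u` gives the same number, so the coefficient is that number times how many
  -- there are; the word `w` acting entirely from the left is one of them.
  rw [Finset.sum_congr rfl (g := fun _ => LinearMap.trace ℂ V (G.word w))]
  · rw [Finset.sum_const, nsmul_eq_mul]
    refine mul_ne_zero (Nat.cast_ne_zero.2 (Finset.card_ne_zero.2 ⟨fun i => (w.get i, true), ?_⟩))
      (G.trace_word_ne_zero h0 h1)
    rw [Finset.mem_filter]
    refine ⟨Finset.mem_univ _, ?_⟩
    have e : List.ofFn (fun i => (w.get i, true)) = w.map (·, true) := by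
      conv_rhs => rw [← List.ofFn_get w, List.map_ofFn]
      rfl
    have hl : leftWord (w.map (·, true)) = w := by
      simp [leftWord, List.filter_map, Function.comp_def]
    have hr : rightWord (w.map (·, true)) = [] := by
      simp [rightWord, List.filter_map, Function.comp_def]
    rw [e, hl, hr, List.reverse_nil, singleTraceMonomial, add_comm]
  · intro u hu
    rw [Finset.mem_filter, singleTraceMonomial,
      Finsupp.single_add_single_eq_single_add_single one_ne_zero one_ne_zero] at hu
    -- The cases: all letters act from the right, all act from the left, or the impossible `1 + 1 =
    -- 0`.
    obtain ⟨-, ⟨hl, hr⟩ | ⟨-, hl, hr⟩ | ⟨h, -⟩⟩ := hu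
    · have hl' := leftWord_eq_nil ((Cycle.coe_eq_nil _).1 hl)
      have hrot := Cycle.coe_eq_coe.1 hr
      rw [hl'] at hrot ⊢
      have e0 : Even (((List.ofFn u).map Prod.fst).count 0) := by
        rwa [← List.count_reverse, hrot.perm.count_eq]
      have e1 : Even (((List.ofFn u).map Prod.fst).count 1) := by
        rwa [← List.count_reverse, hrot.perm.count_eq]
      rw [wordSign_eq_one e0 e1, one_mul, ← G.word_reverse_of_even e0 e1,
        G.trace_word_eq_of_isRotated hrot]
    · have hr' := List.reverse_eq_nil_iff.1 ((Cycle.coe_eq_nil _).1 hr)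
      have hrot := Cycle.coe_eq_coe.1 hl
      rw [rightWord_eq_nil hr'] at hrot
      rw [hr', G.trace_word_eq_of_isRotated hrot]
      simp [wordSign]
    · norm_num at h

end Expansion

/-! ### Polynomials vanishing on additive sets and coordinate subspaces -/

theorem eval_bind₁ {σ τ : Type*} (x : τ → ℂ) (f : σ → MvPolynomial τ ℂ) (P : MvPolynomial σ ℂ) :
    MvPolynomial.eval x (MvPolynomial.bind₁ f P) =
      MvPolynomial.eval (fun s => MvPolynomial.eval x (f s)) P :=
  MvPolynomial.eval₂Hom_bind₁ _ _ _ _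

/-- A polynomial that vanishes on a set closed under addition vanishes on its complex span. -/
theorem eval_eq_zero_of_mem_span {σ : Type*} {T : Set (σ → ℂ)}
    (hT : ∀ s ∈ T, ∀ t ∈ T, s + t ∈ T) (h0 : T.Nonempty) {P : MvPolynomial σ ℂ}
    (hP : ∀ t ∈ T, MvPolynomial.eval t P = 0) {x : σ → ℂ} (hx : x ∈ Submodule.span ℂ T) :
    MvPolynomial.eval x P = 0 := by
  obtain ⟨n, z, g, rfl⟩ := Submodule.mem_span_set'.1 hx
  obtain ⟨t₀, ht₀⟩ := h0
  -- the restriction of `P` to `t₀ + span (g i)`, with a parameter for `t₀` as well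
  set Q : MvPolynomial (Option (Fin n)) ℂ := MvPolynomial.bind₁ (fun s =>
    MvPolynomial.C (t₀ s) * MvPolynomial.X none +
      ∑ i, MvPolynomial.C ((g i : σ → ℂ) s) * MvPolynomial.X (some i)) P with hQ
  have eval_Q : ∀ y, MvPolynomial.eval y Q =
      MvPolynomial.eval (y none • t₀ + ∑ i, y (some i) • (g i : σ → ℂ)) P := fun y => by
    rw [hQ, eval_bind₁]
    congr 2
    ext s
    simp [mul_comm]
  have mem_nsmul : ∀ t ∈ T, ∀ k : ℕ, ((k : ℂ) + 1) • t ∈ T := fun t ht k => by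
    induction k with
    | zero => simpa
    | succ k ih =>
      have := hT _ ih _ ht
      nth_rw 2 [← one_smul ℂ t] at this
      rwa [← add_smul, ← Nat.cast_succ] at this
  -- The parameters run over 1, 2, 3, …; zero is left out because `T` need not contain 0.
  have hinf : (Set.range fun k : ℕ => (k : ℂ) + 1).Infinite :=
    Set.infinite_range_of_injective fun a b h => by simpa using h
  have Q_zero : Q = 0 := by
    refine MvPolynomial.funext_set _ (fun _ => hinf) fun y hy => ?_
    rw [map_zero, eval_Q]
    apply hP
    have mem : ∀ j, ∀ t ∈ T, y j • t ∈ T := fun j t ht => by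
      obtain ⟨k, hk⟩ := hy j (Set.mem_univ _)
      rw [← hk]
      exact mem_nsmul t ht k
    have : ∀ s : Finset (Fin n), y none • t₀ + ∑ i ∈ s, y (some i) • (g i : σ → ℂ) ∈ T := by
      classical
      intro s
      induction s using Finset.induction_on with
      | empty => simpa using mem _ _ ht₀
      | insert i s hi ih =>
        rw [Finset.sum_insert hi, add_left_comm, add_comm]
        exact hT _ ih _ (mem _ _ (g i).2)
    exact this _
  -- Parameter 0 at `t₀` removes the auxiliary base point.
  have := eval_Q (fun j => j.elim 0 z)
  rw [Q_zero] at this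
  simpa using this.symm

/-- If `P` vanishes at all points supported on a set `S` of variables, then `P` has no monomial in
the variables of `S` only. -/
theorem coeff_eq_zero_of_eval_eq_zero {σ : Type*} {S : Set σ} {P : MvPolynomial σ ℂ}
    (hP : ∀ x : σ → ℂ, (∀ s ∉ S, x s = 0) → MvPolynomial.eval x P = 0) {m : σ →₀ ℕ}
    (hm : ↑m.support ⊆ S) : MvPolynomial.coeff m P = 0 := by
  classical
  -- Setting the variables outside `S` to zero turns `P` into the zero polynomial but preserves the
  -- coefficients of monomials in `S`.
  set φ : MvPolynomial σ ℂ →ₐ[ℂ] MvPolynomial σ ℂ :=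
    MvPolynomial.bind₁ (fun s => if s ∈ S then MvPolynomial.X s else 0) with hφ
  have h0 : φ P = 0 := by
    refine MvPolynomial.funext fun x => ?_
    rw [hφ, eval_bind₁, map_zero]
    exact hP _ fun s hs => by simp [hs]
  have hc : ∀ R : MvPolynomial σ ℂ, MvPolynomial.coeff m (φ R) = MvPolynomial.coeff m R := by
    intro R
    induction R using MvPolynomial.induction_on' with
    | add p q hp hq => rw [map_add, MvPolynomial.coeff_add, MvPolynomial.coeff_add, hp, hq]
    | monomial u a =>
      by_cases hu : ↑u.support ⊆ S
      · have : φ (MvPolynomial.monomial u a) = MvPolynomial.monomial u a := by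
          rw [hφ, MvPolynomial.bind₁_monomial, MvPolynomial.monomial_eq, Finsupp.prod]
          congr 1
          exact Finset.prod_congr rfl fun s hs => by rw [if_pos (hu hs)]
        rw [this]
      · obtain ⟨s, hs, hsS⟩ := Set.not_subset.1 hu
        have : φ (MvPolynomial.monomial u a) = 0 := by
          rw [hφ, MvPolynomial.bind₁_monomial, Finset.prod_eq_zero hs, mul_zero]
          rw [if_neg hsS, zero_pow (Finsupp.mem_support_iff.1 hs)]
        rw [this, MvPolynomial.coeff_zero, MvPolynomial.coeff_monomial, if_neg]
        rintro rfl
        exact hu hm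
  rw [← hc, h0, MvPolynomial.coeff_zero]

/-! ### Additivity of trace vectors under block sums -/

section TraceVectors

variable {p : ℕ}

/-- The values that the traces of all cyclic words take together. -/
def traceVectors (p : ℕ) : Set (Cycle (Fin 2) → ℂ) :=
  {t | ∃ N, 1 ≤ N ∧ ∃ X ∈ diracParameters p N, traceWord X = t}

theorem trace_reindex {m n : Type*} [Fintype m] [Fintype n] (e : m ≃ n) (M : Matrix m m ℂ) :
    (Matrix.reindex e e M).trace = M.trace := by
  simp only [Matrix.trace, Matrix.diag_apply, Matrix.reindex_apply, Matrix.submatrix_apply]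
  exact Equiv.sum_comp e.symm fun i => M i i

theorem trace_fromBlocks {m n : Type*} [Fintype m] [Fintype n] (A : Matrix m m ℂ)
    (B : Matrix m n ℂ) (C : Matrix n m ℂ) (D : Matrix n n ℂ) :
    (Matrix.fromBlocks A B C D).trace = A.trace + D.trace := by
  simp [Matrix.trace]

/-- The block diagonal sum of two families of matrices. -/
def blockSum {N M : ℕ} (X : Fin 2 → Matrix (Fin N) (Fin N) ℂ)
    (Y : Fin 2 → Matrix (Fin M) (Fin M) ℂ) (μ : Fin 2) :
    Matrix (Fin (N + M)) (Fin (N + M)) ℂ :=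
  Matrix.reindex finSumFinEquiv finSumFinEquiv (Matrix.fromBlocks (X μ) 0 0 (Y μ))

theorem prod_map_blockSum {N M : ℕ} (X : Fin 2 → Matrix (Fin N) (Fin N) ℂ)
    (Y : Fin 2 → Matrix (Fin M) (Fin M) ℂ) (l : List (Fin 2)) :
    (l.map (blockSum X Y)).prod = Matrix.reindex finSumFinEquiv finSumFinEquiv
      (Matrix.fromBlocks (l.map X).prod 0 0 (l.map Y).prod) := by
  induction l with
  | nil => simp [Matrix.submatrix_one_equiv]
  | cons μ l ih =>
    rw [List.map_cons, List.prod_cons, ih, blockSum]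
    simp [Matrix.submatrix_mul_equiv, Matrix.fromBlocks_multiply]

theorem traceWord_blockSum {N M : ℕ} (X : Fin 2 → Matrix (Fin N) (Fin N) ℂ)
    (Y : Fin 2 → Matrix (Fin M) (Fin M) ℂ) :
    traceWord (blockSum X Y) = traceWord X + traceWord Y := by
  ext c
  induction c using Quotient.inductionOn with
  | h l =>
    change traceWord (blockSum X Y) (l : Cycle (Fin 2)) =
      traceWord X (l : Cycle (Fin 2)) + traceWord Y (l : Cycle (Fin 2))
    simp only [traceWord_coe]
    rw [prod_map_blockSum, trace_reindex, trace_fromBlocks]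

theorem blockSum_mem_diracParameters {N M : ℕ} {X : Fin 2 → Matrix (Fin N) (Fin N) ℂ}
    {Y : Fin 2 → Matrix (Fin M) (Fin M) ℂ} (hX : X ∈ diracParameters p N)
    (hY : Y ∈ diracParameters p M) : blockSum X Y ∈ diracParameters p (N + M) := by
  intro μ
  refine ⟨?_, fun h => ?_⟩
  · have h : metricSign p μ • blockSum X Y μ =
        Matrix.reindex finSumFinEquiv finSumFinEquiv
          (metricSign p μ • Matrix.fromBlocks (X μ) 0 0 (Y μ)) := rfl
    rw [h, blockSum, Matrix.conjTranspose_reindex, Matrix.fromBlocks_conjTranspose, (hX μ).1,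
      (hY μ).1, Matrix.fromBlocks_smul]
    simp
  · rw [blockSum, trace_reindex, trace_fromBlocks, (hX μ).2 h, (hY μ).2 h, add_zero]

theorem add_mem_traceVectors {s t : Cycle (Fin 2) → ℂ} (hs : s ∈ traceVectors p)
    (ht : t ∈ traceVectors p) : s + t ∈ traceVectors p := by
  obtain ⟨N, hN, X, hX, rfl⟩ := hs
  obtain ⟨M, _, Y, hY, rfl⟩ := ht
  exact ⟨N + M, by omega, blockSum X Y, blockSum_mem_diracParameters hX hY,
    traceWord_blockSum X Y⟩

theorem zero_mem_diracParameters (p N : ℕ) : 0 ∈ diracParameters p N := fun μ => by simp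

end TraceVectors

/-! ### Linear independence of traces of cyclic words -/

section LinearIndependence

variable {p : ℕ} {N : ℕ}

theorem traceWord_eq_trace_out (X : Fin 2 → Matrix (Fin N) (Fin N) ℂ) (c : Cycle (Fin 2)) :
    traceWord X c = ((c.out.map X).prod).trace := by
  conv_lhs => rw [← Quotient.out_eq c]
  rfl

theorem length_out (c : Cycle (Fin 2)) : c.out.length = c.length := by
  conv_rhs => rw [← Quotient.out_eq c]
  rfl

theorem exists_eval_eq_traceWord (Y : Fin 2 → Matrix (Fin N) (Fin N) (Polynomial ℂ))
    (c : Cycle (Fin 2)) :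
    ∃ q : Polynomial ℂ, ∀ z, q.eval z = traceWord (fun μ => (Y μ).map (Polynomial.eval z)) c := by
  refine ⟨((c.out.map Y).prod).trace, fun z => ?_⟩
  rw [traceWord_eq_trace_out]
  have h := map_list_prod (Polynomial.evalRingHom z).mapMatrix (c.out.map Y)
  rw [List.map_map] at h
  refine Eq.trans ?_ (congrArg Matrix.trace h)
  exact AddMonoidHom.map_trace (Polynomial.evalRingHom z) _

theorem traceWord_smul (X : Fin 2 → Matrix (Fin N) (Fin N) ℂ) (t : ℂ) (c : Cycle (Fin 2)) :
    traceWord (t • X) c = t ^ c.length * traceWord X c := by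
  rw [traceWord_eq_trace_out, traceWord_eq_trace_out, ← length_out]
  have h : ∀ l : List (Fin 2), (l.map (t • X)).prod = t ^ l.length • (l.map X).prod := fun l => by
    induction l with
    | nil => simp
    | cons μ l ih =>
      rw [List.map_cons, List.prod_cons, ih]
      simp [pow_succ', smul_smul, mul_comm]
  rw [h, Matrix.trace_smul, smul_eq_mul]

/-- A linear relation between traces of words that holds for the (anti-)Hermitian matrices also
holds for complex matrices. -/
theorem sum_mul_traceWord_eq_zero {F : Finset (Cycle (Fin 2))} {a : Cycle (Fin 2) → ℂ}
    (h : ∀ X ∈ diracParameters p N, ∑ c ∈ F, a c * traceWord X c = 0)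
    {X : Fin 2 → Matrix (Fin N) (Fin N) ℂ}
    (hX : ∀ μ, metricSign p μ = -1 → (X μ).trace = 0) :
    ∑ c ∈ F, a c * traceWord X c = 0 := by
  -- `X = U + i W`, where `U` and `W` both satisfy the (anti-)Hermiticity conditions. Along `U + z
  -- W` the relation is a polynomial in `z` that vanishes for real `z`, hence also at `z = i`.
  set U : Fin 2 → Matrix (Fin N) (Fin N) ℂ := fun μ =>
    (2⁻¹ : ℂ) • (X μ + metricSign p μ • (X μ).conjTranspose) with hU
  set W : Fin 2 → Matrix (Fin N) (Fin N) ℂ := fun μ =>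
    (-Complex.I * 2⁻¹) • (X μ - metricSign p μ • (X μ).conjTranspose) with hW
  choose q hq using exists_eval_eq_traceWord
    (fun μ => (U μ).map Polynomial.C + (Polynomial.X : Polynomial ℂ) • (W μ).map Polynomial.C)
  have hq' : ∀ c z, (q c).eval z = traceWord (U + z • W) c := fun c z => by
    rw [hq]
    congr 1
    ext μ i j
    simp
    ring
  have hstar : ∀ μ, star (metricSign p μ) = metricSign p μ := fun μ => by
    unfold metricSign; split_ifs <;> simp
  have hreal : ∀ r : ℝ, U + (r : ℂ) • W ∈ diracParameters p N := fun r μ => by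
    refine ⟨?_, fun hμ => ?_⟩
    · ext i j
      have hs := metricSign_mul_self (p := p) μ
      have hs' := hstar μ
      simp only [Complex.star_def] at hs'
      simp only [hU, hW, Pi.add_apply, Pi.smul_apply, Matrix.conjTranspose_apply, Matrix.add_apply,
        Matrix.smul_apply, Matrix.sub_apply, smul_eq_mul, Complex.star_def, map_add, map_mul,
        map_sub, map_neg, map_inv₀, Complex.conj_I, Complex.conj_ofReal, Complex.conj_conj, hs',
        map_ofNat]
      linear_combination (-(2⁻¹ : ℂ) * (starRingEnd ℂ) (X μ j i) -
        (r : ℂ) * Complex.I * 2⁻¹ * (starRingEnd ℂ) (X μ j i)) * hs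
    · simp [hU, hW, hX μ hμ, Matrix.trace_conjTranspose]
  have hQ : ∑ c ∈ F, Polynomial.C (a c) * q c = 0 := by
    refine Polynomial.eq_zero_of_infinite_isRoot _ (Set.Infinite.mono ?_
      (Set.infinite_range_of_injective Complex.ofReal_injective))
    rintro _ ⟨r, rfl⟩
    have := h _ (hreal r)
    simpa [Polynomial.IsRoot, Polynomial.eval_finsetSum, hq'] using this
  have hI : U + Complex.I • W = X := by
    ext μ i j
    simp only [hU, hW, Pi.add_apply, Pi.smul_apply, Matrix.conjTranspose_apply, Matrix.add_apply,
        Matrix.smul_apply, Matrix.sub_apply, smul_eq_mul]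
    linear_combination (-(2⁻¹ : ℂ) * (X μ i j - metricSign p μ * star (X μ j i))) *
      Complex.I_mul_I
  have := congrArg (Polynomial.eval Complex.I) hQ
  simpa [Polynomial.eval_finsetSum, hq', hI] using this

/-- A linear relation between traces of words splits into homogeneous ones. -/
theorem sum_filter_mul_traceWord_eq_zero {F : Finset (Cycle (Fin 2))} {a : Cycle (Fin 2) → ℂ}
    (h : ∀ X ∈ diracParameters p N, ∑ c ∈ F, a c * traceWord X c = 0)
    {X : Fin 2 → Matrix (Fin N) (Fin N) ℂ}
    (hX : ∀ μ, metricSign p μ = -1 → (X μ).trace = 0) (n : ℕ) :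
    ∑ c ∈ F with c.length = n, a c * traceWord X c = 0 := by
  -- The relation at `t • X` is a polynomial in `t`; its coefficients are the homogeneous parts.
  have hQ : ∑ c ∈ F, Polynomial.monomial c.length (a c * traceWord X c) = 0 := by
    refine Polynomial.funext fun t => ?_
    have := sum_mul_traceWord_eq_zero h (X := t • X) fun μ hμ => by simp [hX μ hμ]
    simp only [traceWord_smul] at this
    rw [Polynomial.eval_finsetSum, Polynomial.eval_zero, ← this]
    refine Finset.sum_congr rfl fun c _ => ?_
    rw [Polynomial.eval_monomial]
    ring
  have := congrArg (Polynomial.coeff · n) hQ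
  simpa [Polynomial.coeff_monomial, Finset.sum_filter] using this

/-- The cyclic shift matrix, split according to a labelling `g` of its rows by the two letters. -/
def shiftMatrix {n : ℕ} (s : Fin n → Fin n) (g : Fin n → Fin 2) (μ : Fin 2) :
    Matrix (Fin n) (Fin n) ℂ :=
  fun i j => if g i = μ ∧ s i = j then 1 else 0

/-- The only path from `i` follows the iterates of `s`, and `v` must be the sequence of labels met
on it. -/
theorem prod_map_shiftMatrix {n : ℕ} (s : Fin n → Fin n) (g : Fin n → Fin 2)
    (v : List (Fin 2)) (i j : Fin n) :
    (v.map (shiftMatrix s g)).prod i j =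
      if v = (List.iterate s i v.length).map g ∧ s^[v.length] i = j then 1 else 0 := by
  induction v generalizing i with
  | nil => simp [Matrix.one_apply]
  | cons μ v ih =>
    rw [List.map_cons, List.prod_cons, Matrix.mul_apply]
    simp only [ih, shiftMatrix]
    rw [Finset.sum_eq_single (s i)]
    · simp only [and_true, List.length_cons, List.iterate, List.map_cons, List.cons.injEq,
        Function.iterate_succ_apply, @eq_comm _ (g i), ite_mul, one_mul, zero_mul, ite_and]
    · intro k _ hk
      rw [if_neg (fun h => hk h.2.symm), zero_mul]
    · simp

/-- The successor modulo `n`. -/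
def cyclicSucc {n : ℕ} (i : Fin n) : Fin n := ⟨(i + 1) % n, Nat.mod_lt _ i.pos⟩

theorem iterate_cyclicSucc {n : ℕ} (i : Fin n) (k : ℕ) :
    ((cyclicSucc^[k] i : Fin n) : ℕ) = (i + k) % n := by
  induction k with
  | zero => simp [Nat.mod_eq_of_lt i.2]
  | succ k ih => simp [Function.iterate_succ_apply', cyclicSucc, ih, add_assoc]

theorem iterate_map_get (l : List (Fin 2)) (i : Fin l.length) :
    (List.iterate cyclicSucc i l.length).map l.get = l.rotate i := by
  refine List.ext_getElem (by simp) fun k h1 h2 => ?_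
  simp [List.getElem_rotate, iterate_cyclicSucc, add_comm]

/-- One full turn around the cycle reads a rotation of `l`, so no other word of that length has a
nonzero diagonal entry. -/
theorem traceWord_shiftMatrix_of_ne {l : List (Fin 2)} {c : Cycle (Fin 2)}
    (hlen : c.length = l.length) (hc : c ≠ l) :
    traceWord (shiftMatrix cyclicSucc l.get) c = 0 := by
  induction c using Quotient.inductionOn with
  | h v =>
    change v.length = l.length at hlen
    change ((v.map (shiftMatrix cyclicSucc l.get)).prod).trace = 0
    refine Finset.sum_eq_zero fun i _ => ?_
    rw [Matrix.diag_apply, prod_map_shiftMatrix, if_neg]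
    rintro ⟨h, -⟩
    rw [hlen, iterate_map_get] at h
    exact hc (Cycle.coe_eq_coe.2 (List.IsRotated.symm ⟨i, h.symm⟩))

theorem traceWord_shiftMatrix_self_ne_zero {l : List (Fin 2)} (hl : l ≠ []) :
    traceWord (shiftMatrix cyclicSucc l.get) (l : Cycle (Fin 2)) ≠ 0 := by
  have hpos := List.length_pos_iff.2 hl
  rw [traceWord_coe, Matrix.trace]
  simp only [Matrix.diag_apply, prod_map_shiftMatrix, iterate_map_get]
  rw [Finset.sum_boole, Nat.cast_ne_zero, Finset.card_ne_zero]
  refine ⟨⟨0, hpos⟩, ?_⟩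
  rw [Finset.mem_filter]
  refine ⟨Finset.mem_univ _, by simp, ?_⟩
  ext
  simp [iterate_cyclicSucc]

/-- The cyclic words whose trace does not vanish identically. -/
def admissibleWords (p : ℕ) : Set (Cycle (Fin 2)) :=
  {c | ∀ μ, metricSign p μ = -1 → c ≠ (([μ] : List (Fin 2)) : Cycle (Fin 2))}

theorem traceWord_eq_zero_of_not_admissible {X : Fin 2 → Matrix (Fin N) (Fin N) ℂ}
    (hX : X ∈ diracParameters p N) {c : Cycle (Fin 2)} (hc : c ∉ admissibleWords p) :
    traceWord X c = 0 := by
  simp only [admissibleWords, Set.mem_ofPred_eq, not_forall, not_not] at hc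
  obtain ⟨μ, hμ, rfl⟩ := hc
  simpa using (hX μ).2 hμ

/-- A nonzero diagonal entry needs a fixed point of the cyclic successor, which forces length one;
`l` is then the excluded word `[μ]`. -/
theorem trace_shiftMatrix_eq_zero {l : List (Fin 2)} (hl : (l : Cycle (Fin 2)) ∈ admissibleWords p)
    {μ : Fin 2} (hμ : metricSign p μ = -1) :
    (shiftMatrix cyclicSucc l.get μ).trace = 0 := by
  refine Finset.sum_eq_zero fun i _ => if_neg ?_
  rintro ⟨h, hi⟩
  have hi' := congrArg Fin.val hi
  simp only [cyclicSucc] at hi'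
  have h1 : l.length = 1 := by
    have := i.2
    rcases Nat.lt_or_ge (i + 1) l.length with h2 | h2
    · rw [Nat.mod_eq_of_lt h2] at hi'; omega
    · have : (i : ℕ) + 1 = l.length := by omega
      rw [this, Nat.mod_self] at hi'; omega
  obtain ⟨ν, rfl⟩ := List.length_eq_one_iff.1 h1
  have : ν = μ := by simpa using h
  exact hl μ hμ (by rw [this])

theorem traceWord_zero (c : Cycle (Fin 2)) :
    traceWord (0 : Fin 2 → Matrix (Fin N) (Fin N) ℂ) c = if c.length = 0 then (N : ℂ) else 0 := by
  induction c using Quotient.inductionOn with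
  | h l =>
    change ((l.map 0).prod : Matrix (Fin N) (Fin N) ℂ).trace = if l.length = 0 then (N : ℂ) else 0
    cases l <;> simp

/-- The traces of the admissible words are linearly independent. -/
theorem eq_zero_of_sum_mul_traceWord_eq_zero {F : Finset (Cycle (Fin 2))}
    (hF : ↑F ⊆ admissibleWords p) {a : Cycle (Fin 2) → ℂ}
    (h : ∀ N, 1 ≤ N → ∀ X ∈ diracParameters p N, ∑ c ∈ F, a c * traceWord X c = 0)
    {c : Cycle (Fin 2)} (hc : c ∈ F) : a c = 0 := by
  induction c using Quotient.inductionOn with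
  | h l =>
    change (l : Cycle (Fin 2)) ∈ F at hc
    change a (l : Cycle (Fin 2)) = 0
    by_cases hl : l = []
    · subst hl
      -- In degree 0 only the empty word remains, with trace 1 at size 1.
      have := sum_filter_mul_traceWord_eq_zero (h 1 le_rfl) (X := 0) (fun μ _ => by simp) 0
      rw [Finset.sum_eq_single (([] : List (Fin 2)) : Cycle (Fin 2))] at this
      · rw [traceWord_coe] at this
        simpa using this
      · intro d hd hne
        rw [Finset.mem_filter] at hd
        induction d using Quotient.inductionOn with
        | h v =>
          have : v = [] := List.length_eq_zero_iff.1 hd.2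
          exact absurd (by rw [this]; rfl) hne
      · intro hn
        exact (hn (by rw [Finset.mem_filter]; exact ⟨hc, rfl⟩)).elim
    · have := sum_filter_mul_traceWord_eq_zero (h l.length (List.length_pos_iff.2 hl))
        (X := shiftMatrix cyclicSucc l.get)
        (fun μ hμ => trace_shiftMatrix_eq_zero (hF hc) hμ) l.length
      rw [Finset.sum_eq_single (l : Cycle (Fin 2))] at this
      · exact (mul_eq_zero.1 this).resolve_right (traceWord_shiftMatrix_self_ne_zero hl)
      · intro d hd hne
        rw [traceWord_shiftMatrix_of_ne (Finset.mem_filter.1 hd).2 hne, mul_zero]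
      · intro hn
        exact (hn (by rw [Finset.mem_filter]; exact ⟨hc, rfl⟩)).elim

end LinearIndependence

/-! ### Uniqueness of coefficients on admissible words -/

/-- On finitely many admissible words the linear combinations of trace vectors take all values. -/
theorem exists_mem_span_traceVectors {p : ℕ} {F : Finset (Cycle (Fin 2))}
    (hF : ↑F ⊆ admissibleWords p) (x : Cycle (Fin 2) → ℂ) :
    ∃ t ∈ Submodule.span ℂ (traceVectors p), ∀ c ∈ F, t c = x c := by
  classical
  set ρ : (Cycle (Fin 2) → ℂ) →ₗ[ℂ] (F → ℂ) :=
    LinearMap.funLeft ℂ ℂ (fun c : F => (c : Cycle (Fin 2)))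
  suffices h : (Submodule.span ℂ (traceVectors p)).map ρ = ⊤ by
    have hx : ρ x ∈ (Submodule.span ℂ (traceVectors p)).map ρ := by rw [h]; trivial
    obtain ⟨t, ht, e⟩ := hx
    exact ⟨t, ht, fun c hc => congrFun e ⟨c, hc⟩⟩
  by_contra hne
  -- A nonzero functional killing the image of the span would be a linear relation between traces of
  -- admissible words.
  obtain ⟨f, hf, hle⟩ := Submodule.exists_le_ker_of_lt_top _ (lt_top_iff_ne_top.2 hne)
  set a : Cycle (Fin 2) → ℂ := fun c => if hc : c ∈ F then f (Pi.single ⟨c, hc⟩ 1) else 0 with ha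
  have hsum : ∀ y : Cycle (Fin 2) → ℂ, f (ρ y) = ∑ c ∈ F, a c * y c := fun y => by
    rw [LinearMap.pi_apply_eq_sum_univ f, ← Finset.sum_coe_sort F]
    refine Finset.sum_congr rfl fun c _ => ?_
    rw [smul_eq_mul, mul_comm, ha]
    simp only [c.2, dite_true]
    congr 2
    ext d
    simp [Pi.single_apply, eq_comm]
  have ha0 : ∀ c ∈ F, a c = 0 := fun c hc =>
    eq_zero_of_sum_mul_traceWord_eq_zero hF (fun N hN X hX => by
      rw [← hsum]
      exact hle (Submodule.mem_map_of_mem (Submodule.subset_span ⟨N, hN, X, hX, rfl⟩))) hc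
  refine hf (LinearMap.ext fun y => ?_)
  obtain ⟨y', rfl⟩ := LinearMap.funLeft_surjective_of_injective ℂ ℂ _ Subtype.val_injective y
  change f (ρ y') = 0
  rw [hsum]
  exact Finset.sum_eq_zero fun c hc => by rw [ha0 c hc, zero_mul]

/-- A trace polynomial that vanishes on all parameter spaces has no monomials in the traces of
admissible words. -/
theorem coeff_eq_zero_of_eval_traceWord_eq_zero {p : ℕ} {P : TracePolynomial}
    (hP : ∀ N, 1 ≤ N → ∀ X ∈ diracParameters p N, MvPolynomial.eval (traceWord X) P = 0)
    {m : Cycle (Fin 2) →₀ ℕ} (hm : ↑m.support ⊆ admissibleWords p) :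
    MvPolynomial.coeff m P = 0 := by
  classical
  refine coeff_eq_zero_of_eval_eq_zero (fun x hx => ?_) hm
  obtain ⟨t, ht, e⟩ := exists_mem_span_traceVectors (p := p)
    (F := P.vars.filter (· ∈ admissibleWords p)) (fun c hc => by simp at hc; exact hc.2) x
  have ht0 : ∀ c ∉ admissibleWords p, t c = 0 := fun c hc => by
    clear e
    induction ht using Submodule.span_induction with
    | mem t ht =>
      obtain ⟨N, -, X, hX, rfl⟩ := ht
      exact traceWord_eq_zero_of_not_admissible hX hc
    | zero => rfl
    | add s t _ _ hs ht => rw [Pi.add_apply, hs, ht, add_zero]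
    | smul z t _ ht => rw [Pi.smul_apply, ht, smul_zero]
  -- `x` and `t` agree on every variable of `P`: on admissible words by the choice of `t`, on the
  -- others because both vanish.
  have hxt : MvPolynomial.eval x P = MvPolynomial.eval t P := by
    refine MvPolynomial.eval₂Hom_congr' rfl (fun c hc _ => ?_) rfl
    by_cases h : c ∈ admissibleWords p
    · exact (e c (Finset.mem_filter.2 ⟨hc, h⟩)).symm
    · rw [hx c h, ht0 c h]
  rw [hxt]
  refine eval_eq_zero_of_mem_span (fun _ hs _ ht => add_mem_traceVectors hs ht)
    ⟨_, 1, le_rfl, 0, zero_mem_diracParameters p 1, rfl⟩ ?_ ht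
  rintro _ ⟨N, hN, X, hX, rfl⟩
  exact hP N hN X hX

/-- A one-letter word has an odd letter count, so neither `w` nor the empty word is excluded. -/
theorem support_singleTraceMonomial_subset {p : ℕ} {w : List (Fin 2)} (h0 : Even (w.count 0))
    (h1 : Even (w.count 1)) : ↑(singleTraceMonomial w).support ⊆ admissibleWords p := by
  intro c hc μ _ hμ
  have : c ∈ ({(([] : List (Fin 2)) : Cycle (Fin 2)), (w : Cycle (Fin 2))} : Set _) := by
    by_contra hn
    simp only [Set.mem_insert_iff, Set.mem_singleton_iff, not_or] at hn
    refine Finsupp.mem_support_iff.1 hc ?_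
    rw [singleTraceMonomial, Finsupp.add_apply, Finsupp.single_eq_of_ne hn.1,
      Finsupp.single_eq_of_ne hn.2, add_zero]
  rcases this with rfl | rfl
  · exact absurd (congrArg Cycle.length hμ) (by simp)
  · have hp := (Cycle.coe_eq_coe.1 hμ).perm
    rw [hp.count_eq] at h0 h1
    fin_cases μ <;> simp at h0 h1

end FuzzyGeometry

theorem lemma3p1 (p q : ℕ) (hpq : p + q = 2)
    {V : Type*} [NormedAddCommGroup V] [InnerProductSpace ℂ V] [FiniteDimensional ℂ V]
    [Nontrivial V] (G : FuzzyGeometry.GammaMatrices p V)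
    (w : List (Fin 2)) (hA : Even (w.count 0)) (hB : Even (w.count 1)) :
    (∃ P : FuzzyGeometry.TracePolynomial,
      FuzzyGeometry.IsSpectralActionExpansion G (w.count 0 + w.count 1) P) ∧
    ∃ c : ℂ, c ≠ 0 ∧ ∀ P : FuzzyGeometry.TracePolynomial,
      FuzzyGeometry.IsSpectralActionExpansion G (w.count 0 + w.count 1) P →
        MvPolynomial.coeff (FuzzyGeometry.singleTraceMonomial w) P = c := by
  have h₀ := FuzzyGeometry.isSpectralActionExpansion_diracExpansion G (w.count 0 + w.count 1)
  refine ⟨⟨_, h₀⟩, _, FuzzyGeometry.coeff_diracExpansion_ne_zero G w hA hB, fun P hP => ?_⟩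
  rw [← sub_eq_zero, ← MvPolynomial.coeff_sub]
  refine FuzzyGeometry.coeff_eq_zero_of_eval_traceWord_eq_zero (p := p) (fun N hN X hX => ?_)
    (FuzzyGeometry.support_singleTraceMonomial_subset hA hB)
  rw [map_sub, ← hP N hN X hX, ← h₀ N hN X hX, sub_self]
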